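/- Let $A$ be a (not necessarily unital) complex C*-algebra. Let $\operatorname{Prim}(A)$ be the set of its primitive ideals, i.e. of the kernels of the strictly irreducible representations $\pi:A\to L(X)$ on complex linear spaces $X\neq 0$ (strictly irreducible: $\pi(A)\xi=X$ for every nonzero $\xi\in X$), equipped with the Jacobson (hull-kernel) topology, whose closed sets are the sets $\{I\in\operatorname{Prim}(A):E\subset I\}$, $E\subset A$. Suppose that $\operatorname{Prim}(A)$ has property (QC): the intersection of any down-directed net of nonempty quasicompact subsets of $\operatorname{Prim}(A)$ is nonempty (quasicompact: every open covering has a finite subcovering, no separation being required). For a bounded subset $M$ of a normed algebra let $\|M\|=\sup_{a\in M}\|a\|$, let $M^n=\{a_1\cdots a_n: a_i\in M\}$, and let $\rho(M)=\inf_{n\ge 1}\|M^n\|^{1/n}$ be the joint spectral radius of $M$. For a primitive ideal $I$ of $A$ let $M/I$ be the image of $M$ in the quotient algebra $A/I$ with its quotient norm. Then for every precompact (i.e. totally bounded) subset $M$ of $A$ the set $\{\rho(M/I): I\in\operatorname{Prim}(A)\}$ is bounded above and \[ \rho(M)=\sup_{I\in\operatorname{Prim}(A)}\rho(M/I). \]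 Here suprema of nonnegative quantities over the empty set are taken to be $0$. -/

import Mathlib

universe u

/-! ### Joint spectral radius -/

section JointSpectralRadius

variable {B : Type*} [Mul B] [Norm B]

/-- The norm `‖M‖ = sup {‖a‖ : a ∈ M}` of a bounded set `M` (it is `0` when `M` is empty). -/
noncomputable def setNorm (M : Set B) : ℝ := sSup ((fun a : B => ‖a‖) '' M)

/-- `setPowSucc M n` is the set `M ^ (n + 1)` of all products `a₁ * ⋯ * aₙ₊₁` with all
factors in `M`. -/
def setPowSucc (M : Set B) : ℕ → Set B
  | 0 => M
  | n + 1 => Set.image2 (fun a b => a * b) (setPowSucc M n) M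

/-- The joint spectral radius `ρ(M) = inf {‖M ^ n‖ ^ (1 / n) : n ≥ 1}` of a bounded set `M`. -/
noncomputable def jointSpectralRadius (M : Set B) : ℝ :=
  ⨅ n : ℕ, setNorm (setPowSucc M n) ^ (1 / ((n : ℝ) + 1))

end JointSpectralRadius

/-! ### Quotients by two-sided ideals -/

/-- The quotient norm `‖x‖ = inf {‖a‖ : a / I = x}` on `A / I`. -/
noncomputable instance TwoSidedIdeal.instNormQuotient {A : Type*} [NonUnitalNormedRing A]
    (I : TwoSidedIdeal A) : Norm I.ringCon.Quotient where
  norm x := sInf ((fun a : A => ‖a‖) '' {a : A | (a : I.ringCon.Quotient) = x})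

/-- The image `M / I` of a set `M` in the quotient algebra `A / I`. -/
def setQuotient {A : Type*} [NonUnitalNormedRing A] (M : Set A) (I : TwoSidedIdeal A) :
    Set I.ringCon.Quotient :=
  (fun a : A => (a : I.ringCon.Quotient)) '' M

/-! ### Primitive ideals -/

section Primitive

/-- A representation of `A` on a complex linear space `X` is strictly irreducible if `X ≠ 0`
and `π(A)ξ = X` for every nonzero `ξ` in `X`. -/
def IsStrictlyIrreducible {A X : Type*} [NonUnitalRing A] [Module ℂ A] [AddCommGroup X]
    [Module ℂ X] (π : A →ₙₐ[ℂ] Module.End ℂ X) : Prop :=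
  Nontrivial X ∧ ∀ ξ : X, ξ ≠ 0 → {η : X | ∃ a : A, π a ξ = η} = Set.univ

/-- An ideal is primitive if it is the kernel of a strictly irreducible representation.
Such a representation is equivalent to one on a quotient of `A` by a left ideal, so it is enough
to consider linear spaces in the universe of `A`. -/
def IsPrimitiveIdeal {A : Type u} [NonUnitalRing A] [Module ℂ A] (I : TwoSidedIdeal A) : Prop :=
  ∃ (X : Type u) (_ : AddCommGroup X) (_ : Module ℂ X) (π : A →ₙₐ[ℂ] Module.End ℂ X),
    IsStrictlyIrreducible π ∧ ∀ a : A, a ∈ I ↔ π a = 0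

/-- The set `Prim(A)` of all primitive ideals. -/
def PrimitiveSpace (A : Type u) [NonUnitalRing A] [Module ℂ A] : Type u :=
  {I : TwoSidedIdeal A // IsPrimitiveIdeal I}

variable {A : Type u} [NonUnitalRing A] [Module ℂ A]

/-- The hull `h(E)` of a subset `E` of `A`: all primitive ideals that contain `E`. -/
def hull (E : Set A) : Set (PrimitiveSpace A) := {I | E ⊆ (I.1 : Set A)}

/-- A primitive ideal is proper. -/
theorem PrimitiveSpace.exists_not_mem (I : PrimitiveSpace A) : ∃ a : A, a ∉ I.1 := by
  obtain ⟨I, X, _, _, π, ⟨hX, hirr⟩, hI⟩ := I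
  obtain ⟨ξ, hξ⟩ := exists_ne (0 : X)
  obtain ⟨a, ha⟩ : ∃ a : A, π a ξ = ξ := by
    have : ξ ∈ {η : X | ∃ a : A, π a ξ = η} := by rw [hirr ξ hξ]; trivial
    exact this
  refine ⟨a, fun h => hξ ?_⟩
  rw [← ha, (hI a).1 h, LinearMap.zero_apply]

/-- A primitive ideal is prime. -/
theorem PrimitiveSpace.mem_or_mem (I : PrimitiveSpace A) {e f : A}
    (h : ∀ a : A, e * a * f ∈ I.1) : e ∈ I.1 ∨ f ∈ I.1 := by
  obtain ⟨I, X, _, _, π, ⟨hX, hirr⟩, hI⟩ := I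
  by_contra hcon
  push Not at hcon
  obtain ⟨he, hf⟩ := hcon
  rw [hI] at he hf
  obtain ⟨ξ, hξ⟩ : ∃ ξ, π f ξ ≠ 0 := by
    by_contra hc
    push Not at hc
    exact hf (LinearMap.ext hc)
  refine he (LinearMap.ext fun η => ?_)
  obtain ⟨a, ha⟩ : ∃ a : A, π a (π f ξ) = η := by
    have : η ∈ {η : X | ∃ a : A, π a (π f ξ) = η} := by rw [hirr _ hξ]; trivial
    exact this
  have h0 := (hI _).1 (h a)
  rw [← ha, LinearMap.zero_apply]
  have := congrArg (fun T : Module.End ℂ X => T ξ) h0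
  simpa [map_mul] using this

/-- The Jacobson (hull-kernel) topology on `Prim(A)`: the closed sets are the hulls of the
subsets of `A`. -/
instance PrimitiveSpace.instTopologicalSpace : TopologicalSpace (PrimitiveSpace A) :=
  TopologicalSpace.ofClosed (Set.range (hull (A := A)))
    ⟨Set.univ, by
      ext I
      obtain ⟨a, ha⟩ := I.exists_not_mem
      exact iff_of_false (fun h => ha (h (Set.mem_univ a))) (Set.notMem_empty I)⟩
    (fun S hS => ⟨⋃₀ {E | hull E ∈ S}, by
      ext I
      constructor
      · intro hI F hF
        obtain ⟨E, rfl⟩ := hS hF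
        exact fun a ha => hI ⟨E, hF, ha⟩
      · rintro hI a ⟨E, hE, ha⟩
        exact hI _ hE ha⟩)
    (by
      rintro _ ⟨E, rfl⟩ _ ⟨F, rfl⟩
      refine ⟨{x | ∀ J ∈ hull E ∪ hull F, x ∈ J.1}, ?_⟩
      ext I
      constructor
      · intro hI
        by_contra hcon
        rw [Set.mem_union, not_or] at hcon
        obtain ⟨e, he, heI⟩ := Set.not_subset.1 hcon.1
        obtain ⟨f, hf, hfI⟩ := Set.not_subset.1 hcon.2
        rcases I.mem_or_mem (e := e) (f := f) (fun a => hI (by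
          rintro J (hJ | hJ)
          · exact J.1.mul_mem_right _ _ (J.1.mul_mem_right _ _ (hJ he))
          · exact J.1.mul_mem_left _ _ (hJ hf))) with h | h
        · exact heI h
        · exact hfI h
      · exact fun hI x hx => hx I hI)

end Primitive

/-! ### Property (QC) -/

/-- Property (QC) of a topological space: every (nonempty) down-directed system of nonempty
quasicompact subsets has nonempty intersection.  (`IsCompact` means quasicompact: no separation
is required.) -/
def PropertyQC (T : Type*) [TopologicalSpace T] : Prop :=
  ∀ S : Set (Set T), S.Nonempty → DirectedOn (fun K L => L ⊆ K) S →
    (∀ K ∈ S, K.Nonempty ∧ IsCompact K) → (⋂₀ S).Nonempty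

/-! The inequality `ρ(M/I) ≤ ρ(M)` is immediate. For the converse let `0 < t < ρ(M)` and let `K n`
be the set of primitive `I` with `t ^ (n + 1) ≤ ‖(M/I) ^ (n + 1)‖`. Submultiplicativity puts `K` at
the exponent `(n + 1) * (m + 1)` inside both `K n` and `K m`, so the family is down-directed. Each
`K n` is nonempty, because norms are attained in primitive quotients, and quasicompact by
`PrimitiveSpace.isCompact_le_sSup_quotNorm`. Property (QC) yields `I` in every `K n`, that is, `t ≤
ρ(M/I)`.

Both facts about `K n` rest on `IsTwoSidedSubmodule.exists_primitive_quotNorm_le`: above any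
two-sided ideal `J` there is a primitive ideal that does not decrease the quotient norm of a given
`a`. The compactness argument applies it to a directed union of ideals, which need not be closed.
Hence `quotNorm` is treated as a seminorm on `A`, and all functional calculus takes place in `A`
itself, never in `A / J`. -/

/-! ### The quotient seminorm of a linear subspace -/

section QuotientSeminorm

variable {A : Type u} [NonUnitalCStarAlgebra A]

/-- A linear subspace which is a two-sided ideal. -/
structure IsTwoSidedSubmodule (J : Submodule ℂ A) : Prop where
  mul_mem_left : ∀ (x : A) {j : A}, j ∈ J → x * j ∈ J
  mul_mem_right : ∀ (x : A) {j : A}, j ∈ J → j * x ∈ J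

/-- The norm of the image of `a` in `A / J`. -/
noncomputable def quotNorm (J : Submodule ℂ A) (a : A) : ℝ :=
  ‖(Submodule.Quotient.mk a : A ⧸ J)‖

variable {J K : Submodule ℂ A}

theorem quotNorm_nonneg (a : A) : 0 ≤ quotNorm J a := norm_nonneg _

theorem quotNorm_le_norm (a : A) : quotNorm J a ≤ ‖a‖ := Submodule.Quotient.norm_mk_le J a

theorem quotNorm_add_le (a b : A) : quotNorm J (a + b) ≤ quotNorm J a + quotNorm J b := by
  exact norm_add_le (Submodule.Quotient.mk a : A ⧸ J) (Submodule.Quotient.mk b)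

theorem quotNorm_lt_iff {a : A} {r : ℝ} : quotNorm J a < r ↔ ∃ m, a - m ∈ J ∧ ‖m‖ < r := by
  constructor
  · intro h
    obtain ⟨m, hm, hlt⟩ := Submodule.Quotient.norm_mk_lt (Submodule.Quotient.mk a : A ⧸ J)
      (sub_pos.2 h)
    refine ⟨m, (Submodule.Quotient.eq J).1 hm.symm, hlt.trans_eq ?_⟩
    simp [quotNorm]
  · rintro ⟨m, hm, hlt⟩
    rw [quotNorm, (Submodule.Quotient.eq J).2 hm]
    exact (Submodule.Quotient.norm_mk_le J m).trans_lt hlt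

theorem quotNorm_congr {a b : A} (h : a - b ∈ J) : quotNorm J a = quotNorm J b := by
  rw [quotNorm, (Submodule.Quotient.eq J).2 h, quotNorm]

theorem quotNorm_anti (h : J ≤ K) (a : A) : quotNorm K a ≤ quotNorm J a := by
  refine le_of_forall_gt fun r hr => ?_
  obtain ⟨m, hm, hlt⟩ := quotNorm_lt_iff.1 hr
  exact quotNorm_lt_iff.2 ⟨m, h hm, hlt⟩

theorem quotNorm_bot (a : A) : quotNorm (⊥ : Submodule ℂ A) a = ‖a‖ := by
  refine le_antisymm (quotNorm_le_norm a) (le_of_forall_gt fun r hr => ?_)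
  obtain ⟨m, hm, hlt⟩ := quotNorm_lt_iff.1 hr
  rw [Submodule.mem_bot, sub_eq_zero] at hm
  rwa [hm]

theorem abs_quotNorm_sub_le (a b : A) : |quotNorm J a - quotNorm J b| ≤ ‖a - b‖ := by
  refine (abs_norm_sub_norm_le (Submodule.Quotient.mk a : A ⧸ J) (Submodule.Quotient.mk b)).trans ?_
  rw [← Submodule.Quotient.mk_sub]
  exact quotNorm_le_norm _

theorem continuous_quotNorm : Continuous (quotNorm J) :=
  (LipschitzWith.of_dist_le_mul (K := 1) fun a b => by
    simpa [Real.dist_eq, dist_eq_norm] using abs_quotNorm_sub_le a b).continuous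

theorem IsTwoSidedSubmodule.quotNorm_mul_le (hJ : IsTwoSidedSubmodule J) (a b : A) :
    quotNorm J (a * b) ≤ quotNorm J a * quotNorm J b := by
  have key : ∀ r > quotNorm J a, ∀ s > quotNorm J b, quotNorm J (a * b) ≤ r * s := by
    intro r hr s hs
    obtain ⟨m, hm, hmr⟩ := quotNorm_lt_iff.1 hr
    obtain ⟨n, hn, hns⟩ := quotNorm_lt_iff.1 hs
    have : a * b - m * n ∈ J := by
      have h := J.add_mem (hJ.mul_mem_right b hm) (hJ.mul_mem_left m hn)
      convert h using 1
      noncomm_ring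
    rw [quotNorm_congr this]
    refine (quotNorm_le_norm _).trans ((norm_mul_le _ _).trans ?_)
    exact mul_le_mul hmr.le hns.le (norm_nonneg _) ((norm_nonneg _).trans hmr.le)
  have h1 : ∀ r > quotNorm J a, quotNorm J (a * b) ≤ r * quotNorm J b := fun r hr =>
    ge_of_tendsto ((continuous_const.mul continuous_id).continuousWithinAt
      (s := Set.Ioi (quotNorm J b)) (x := quotNorm J b))
      (Filter.eventually_of_mem self_mem_nhdsWithin fun s hs => key r hr s hs)
  exact ge_of_tendsto ((continuous_id.mul continuous_const).continuousWithinAt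
      (s := Set.Ioi (quotNorm J a)) (x := quotNorm J a))
      (Filter.eventually_of_mem self_mem_nhdsWithin fun r hr => h1 r hr)

theorem quotNorm_eq_zero_of_le_mul {a : A} {k : ℝ} (hk : k < 1)
    (h : quotNorm J a ≤ k * quotNorm J a) : quotNorm J a = 0 := by
  have := quotNorm_nonneg (J := J) a
  nlinarith

end QuotientSeminorm

/-! ### Cutting off by functional calculus -/

section Cutoff

/-- The continuous function which vanishes for `t ≤ r` and equals `1 - r / t` for `t ≥ r`. -/
noncomputable def cutoff (r t : ℝ) : ℝ := max (t - r) 0 / max t r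

theorem continuous_cutoff {r : ℝ} (hr : 0 < r) : Continuous (cutoff r) :=
  ((continuous_id.sub continuous_const).max continuous_const).div
    (continuous_id.max continuous_const) fun _ => (lt_max_of_lt_right hr).ne'

theorem cutoff_of_le {r t : ℝ} (h : t ≤ r) : cutoff r t = 0 := by
  simp [cutoff, h]

theorem cutoff_of_ge {r t : ℝ} (hr : 0 < r) (h : r ≤ t) : cutoff r t = 1 - r / t := by
  have : t ≠ 0 := (hr.trans_le h).ne'
  rw [cutoff, max_eq_left (by linarith), max_eq_left h]
  field_simp

variable {A : Type u} [NonUnitalCStarAlgebra A] {J : Submodule ℂ A}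

theorem quasispectrum_real_star_mul_self_nonneg (a : A) :
    ∀ t ∈ quasispectrum ℝ (star a * a), 0 ≤ t := by
  let := CStarAlgebra.spectralOrder A
  have := CStarAlgebra.spectralOrderedRing A
  exact quasispectrum_nonneg_of_nonneg _ (star_mul_self_nonneg a)

/-- With `c` the cutoff of `b`, one has `c = b * g(b) * c`, where `g(t) = 1 / t` for `t ≥ r` and `g
≤ 1 / r` on the spectrum. So the seminorm of `c` is at most `quotNorm J b / r < 1` times itself. -/
theorem IsTwoSidedSubmodule.quotNorm_cutoff_eq_zero (hJ : IsTwoSidedSubmodule J) {b : A}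
    (hb : IsSelfAdjoint b) (hpos : ∀ t ∈ quasispectrum ℝ b, 0 ≤ t) {r : ℝ}
    (hr : quotNorm J b < r) : quotNorm J (cfcₙ (cutoff r) b) = 0 := by
  have hr0 : 0 < r := (quotNorm_nonneg b).trans_lt hr
  have hc := continuous_cutoff hr0
  have hc0 : cutoff r 0 = 0 := cutoff_of_le hr0.le
  have hg : Continuous fun t : ℝ => t / max t r ^ 2 :=
    continuous_id.div ((continuous_id.max continuous_const).pow 2) fun _ =>
      pow_ne_zero _ (lt_max_of_lt_right hr0).ne'
  have hfac : cfcₙ (cutoff r) b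
      = b * (cfcₙ (fun t : ℝ => t / max t r ^ 2) b * cfcₙ (cutoff r) b) := by
    have hgc : Continuous fun t : ℝ => t / max t r ^ 2 * cutoff r t := hg.mul hc
    have hid : Continuous fun t : ℝ => t := continuous_id
    conv_rhs => enter [1]; rw [← cfcₙ_id' ℝ b]
    rw [← cfcₙ_mul _ _ b hg.continuousOn (by simp) hc.continuousOn hc0,
      ← cfcₙ_mul _ _ b hid.continuousOn rfl hgc.continuousOn (by simp)]
    refine cfcₙ_congr fun t _ => ?_
    rcases le_total t r with h | h
    · simp [cutoff_of_le h]
    · have : t ≠ 0 := (hr0.trans_le h).ne'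
      simp only [max_eq_left h]
      field_simp
  have hnorm : ‖cfcₙ (fun t : ℝ => t / max t r ^ 2) b‖ ≤ 1 / r := by
    refine norm_cfcₙ_le fun t ht => ?_
    have h0 := hpos t ht
    have hm : 0 < max t r := lt_max_of_lt_right hr0
    rw [Real.norm_of_nonneg (by positivity), div_le_div_iff₀ (by positivity) hr0]
    nlinarith [le_max_left t r, le_max_right t r]
  refine quotNorm_eq_zero_of_le_mul (k := quotNorm J b / r) ((div_lt_one hr0).2 hr) ?_
  conv_lhs => rw [hfac]
  refine (hJ.quotNorm_mul_le _ _).trans ?_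
  rw [div_eq_mul_one_div, mul_assoc]
  refine mul_le_mul_of_nonneg_left ((hJ.quotNorm_mul_le _ _).trans ?_) (quotNorm_nonneg b)
  exact mul_le_mul_of_nonneg_right ((quotNorm_le_norm _).trans hnorm) (quotNorm_nonneg _)

/-- Modulo the kernel of the seminorm, `a` equals `a - a * c`, and the square of the norm of the
latter is governed by `t * (1 - cutoff r t) ^ 2 ≤ r`. -/
theorem IsTwoSidedSubmodule.quotNorm_sq_le_of_cutoff (hJ : IsTwoSidedSubmodule J) {a : A} {r : ℝ}
    (hr0 : 0 < r) (h : quotNorm J (cfcₙ (cutoff r) (star a * a)) = 0) : quotNorm J a ^ 2 ≤ r := by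
  set b := star a * a with hbdef
  have hb : IsSelfAdjoint b := .star_mul_self a
  set c := cfcₙ (cutoff r) b with hcdef
  have hc := continuous_cutoff hr0
  have hc0 : cutoff r 0 = 0 := cutoff_of_le hr0.le
  have hcs : star c = c := (IsSelfAdjoint.star_eq (cfcₙ_predicate (cutoff r) b))
  have hprod : star (a - a * c) * (a - a * c)
      = cfcₙ (fun t : ℝ => (t - t * cutoff r t) - cutoff r t * (t - t * cutoff r t)) b := by
    have hid : Continuous fun t : ℝ => t := continuous_id
    have hic : Continuous fun t : ℝ => t * cutoff r t := hid.mul hc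
    have hi : Continuous fun t : ℝ => t - t * cutoff r t := hid.sub hic
    have hci : Continuous fun t : ℝ => cutoff r t * (t - t * cutoff r t) := hc.mul hi
    rw [cfcₙ_sub _ _ b hi.continuousOn (by simp) hci.continuousOn (by simp),
      cfcₙ_mul _ _ b hc.continuousOn hc0 hi.continuousOn (by simp),
      cfcₙ_sub _ _ b hid.continuousOn rfl hic.continuousOn (by simp),
      cfcₙ_mul _ _ b hid.continuousOn rfl hc.continuousOn hc0, cfcₙ_id' ℝ b, ← hcdef,
      star_sub, star_mul, hcs, hbdef]
    noncomm_ring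
  have hnorm : ‖a - a * c‖ ^ 2 ≤ r := by
    rw [sq, ← CStarRing.norm_star_mul_self, hprod]
    refine norm_cfcₙ_le fun t ht => ?_
    have h0 := quasispectrum_real_star_mul_self_nonneg a t ht
    rcases le_total t r with h | h
    · simpa [cutoff_of_le h, abs_of_nonneg h0] using h
    · have ht0 : 0 < t := hr0.trans_le h
      rw [cutoff_of_ge hr0 h]
      have : (t - t * (1 - r / t)) - (1 - r / t) * (t - t * (1 - r / t)) = r * (r / t) := by
        field_simp
        ring
      rw [this, Real.norm_of_nonneg (by positivity)]
      exact mul_le_of_le_one_right hr0.le ((div_le_one ht0).2 h)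
  have hle : quotNorm J a ≤ ‖a - a * c‖ := by
    have h1 := quotNorm_add_le (J := J) (a - a * c) (a * c)
    have h2 := hJ.quotNorm_mul_le a c
    rw [h, mul_zero] at h2
    rw [sub_add_cancel] at h1
    linarith [quotNorm_le_norm (J := J) (a - a * c)]
  exact (pow_le_pow_left₀ (quotNorm_nonneg a) hle 2).trans hnorm

theorem IsTwoSidedSubmodule.quotNorm_sq_le (hJ : IsTwoSidedSubmodule J) (a : A) :
    quotNorm J a ^ 2 ≤ quotNorm J (star a * a) :=
  le_of_forall_gt_imp_ge_of_dense fun _ hr =>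
    hJ.quotNorm_sq_le_of_cutoff ((quotNorm_nonneg _).trans_lt hr)
      (hJ.quotNorm_cutoff_eq_zero (.star_mul_self a) (quasispectrum_real_star_mul_self_nonneg a) hr)

theorem IsTwoSidedSubmodule.quotNorm_le_star (hJ : IsTwoSidedSubmodule J) (a : A) :
    quotNorm J a ≤ quotNorm J (star a) := by
  have h := (hJ.quotNorm_sq_le a).trans (hJ.quotNorm_mul_le _ _)
  rcases (quotNorm_nonneg (J := J) a).eq_or_lt with h0 | h0
  · rw [← h0]; exact quotNorm_nonneg _
  · rw [sq] at h
    exact le_of_mul_le_mul_right h h0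

theorem IsTwoSidedSubmodule.quotNorm_star_mul_self_le (hJ : IsTwoSidedSubmodule J) (a : A) :
    quotNorm J (star a * a) ≤ quotNorm J a ^ 2 := by
  rw [sq]
  refine (hJ.quotNorm_mul_le _ _).trans (mul_le_mul_of_nonneg_right ?_ (quotNorm_nonneg a))
  simpa using hJ.quotNorm_le_star (star a)

/-- `t ↦ min t s / s`. -/
noncomputable def truncation (s t : ℝ) : ℝ := min t s / s

theorem continuous_truncation (s : ℝ) : Continuous (truncation s) :=
  (continuous_id.min continuous_const).div_const s

theorem truncation_zero {s : ℝ} (hs : 0 < s) : truncation s 0 = 0 := by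
  simp [truncation, hs.le]

/-- Membership in `J` would mean `(1 + x) * (1 - e) ≡ 1` for the truncation `e`. Multiply by a
cutoff `c` living just below the top value `s`: there `1 - e` is at most `δ`, so `c` has seminorm
zero, which forces `quotNorm J a ^ 2 ≤ r < s`. Truncating at `s` keeps `1 - e` small also on the
part of the spectrum in `A` beyond `s`. -/
theorem IsTwoSidedSubmodule.truncation_not_quasiregular (hJ : IsTwoSidedSubmodule J) {a : A}
    (ha : 0 < quotNorm J a) (x : A) :
    cfcₙ (truncation (quotNorm J a ^ 2)) (star a * a) - x
      + x * cfcₙ (truncation (quotNorm J a ^ 2)) (star a * a) ∉ J := by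
  intro hx
  set s := quotNorm J a ^ 2 with hs
  have hs0 : 0 < s := by positivity
  set b := star a * a with hbdef
  set e := cfcₙ (truncation s) b with hedef
  obtain ⟨δ, hδ0, hδ1, hδx⟩ : ∃ δ : ℝ, 0 < δ ∧ δ < 1 ∧ (1 + ‖x‖) * δ < 1 := by
    have hpos : 0 < 1 + ‖x‖ := by positivity
    refine ⟨1 / (2 * (1 + ‖x‖)), by positivity, ?_, ?_⟩
    · rw [div_lt_one (by positivity)]
      linarith [norm_nonneg x]
    · field_simp
      norm_num
  set r := (1 - δ) * s with hr
  have hr0 : 0 < r := mul_pos (by linarith) hs0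
  have hrs : r < s := by nlinarith
  have hc := continuous_cutoff hr0
  have hc0 : cutoff r 0 = 0 := cutoff_of_le hr0.le
  have he := continuous_truncation s
  have he0 := truncation_zero hs0
  have hec : Continuous fun t : ℝ => truncation s t * cutoff r t := he.mul hc
  set c := cfcₙ (cutoff r) b with hcdef
  -- This function agrees with `1 - truncation s` where the cutoff is nonzero; the minimum with `δ`
  -- bounds it everywhere, and the last factor makes it vanish at `0`, as the nonunital calculus
  -- requires.
  have hv : Continuous fun t : ℝ => min (1 - truncation s t) δ * (min t r / r) :=
    ((continuous_const.sub he).min continuous_const).mul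
      ((continuous_id.min continuous_const).div_const r)
  have hv0 : min (1 - truncation s 0) δ * (min (0 : ℝ) r / r) = 0 := by simp [hr0.le]
  set v := cfcₙ (fun t : ℝ => min (1 - truncation s t) δ * (min t r / r)) b with hvdef
  have hcv : c - e * c = v * c := by
    rw [hcdef, hedef, hvdef, ← cfcₙ_mul _ _ b he.continuousOn he0 hc.continuousOn hc0,
      ← cfcₙ_mul _ _ b hv.continuousOn hv0 hc.continuousOn hc0,
      ← cfcₙ_sub _ _ b hc.continuousOn hc0 hec.continuousOn (by simp [hc0])]
    refine cfcₙ_congr fun t _ => ?_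
    rcases le_total t r with h | h
    · simp [cutoff_of_le h]
    · have h1 : 1 - truncation s t ≤ δ := by
        have : 1 - δ ≤ truncation s t := by
          rw [truncation, le_div_iff₀ hs0]
          exact le_min h hrs.le
        linarith
      simp only [min_eq_left h1, min_eq_right h, div_self hr0.ne']
      ring
  have hvn : ‖v‖ ≤ δ := by
    refine norm_cfcₙ_le fun t ht => ?_
    have h0 := quasispectrum_real_star_mul_self_nonneg a t ht
    have h1 : truncation s t ≤ 1 := (div_le_one hs0).2 (min_le_right _ _)
    have h2 : 0 ≤ min (1 - truncation s t) δ := le_min (by linarith) hδ0.le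
    have h3 : 0 ≤ min t r / r := div_nonneg (le_min h0 hr0.le) hr0.le
    have h4 : min t r / r ≤ 1 := (div_le_one hr0).2 (min_le_right _ _)
    rw [Real.norm_of_nonneg (mul_nonneg h2 h3)]
    exact (mul_le_of_le_one_right h2 h4).trans (min_le_right _ _)
  have hcJ : c - (v * c + x * (v * c)) ∈ J := by
    have h := hJ.mul_mem_right c hx
    convert h using 1
    rw [← hcv]
    noncomm_ring
  have hq : quotNorm J c = 0 := by
    refine quotNorm_eq_zero_of_le_mul hδx ?_
    have h1 : quotNorm J (v * c) ≤ δ * quotNorm J c := (hJ.quotNorm_mul_le _ _).trans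
      (mul_le_mul_of_nonneg_right ((quotNorm_le_norm v).trans hvn) (quotNorm_nonneg c))
    have h2 : quotNorm J (x * (v * c)) ≤ ‖x‖ * (δ * quotNorm J c) := (hJ.quotNorm_mul_le _ _).trans
      (mul_le_mul (quotNorm_le_norm x) h1 (quotNorm_nonneg _) (norm_nonneg x))
    have h3 := quotNorm_add_le (J := J) (v * c) (x * (v * c))
    rw [← quotNorm_congr hcJ] at h3
    linarith
  exact (hJ.quotNorm_sq_le_of_cutoff hr0 hq).not_gt hrs

theorem IsTwoSidedSubmodule.quotNorm_truncation_lt_one (hJ : IsTwoSidedSubmodule J) {a : A}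
    {s : ℝ} (ha : quotNorm J a ^ 2 < s) :
    quotNorm J (cfcₙ (truncation s) (star a * a)) < 1 := by
  obtain ⟨r, hr, hrs⟩ := exists_between ha
  have hr0 : 0 < r := (sq_nonneg _).trans_lt hr
  have hs0 : 0 < s := hr0.trans hrs
  set b := star a * a with hbdef
  have hb : IsSelfAdjoint b := .star_mul_self a
  have hq := hJ.quotNorm_cutoff_eq_zero hb (quasispectrum_real_star_mul_self_nonneg a)
    ((hJ.quotNorm_star_mul_self_le a).trans_lt hr)
  have hc := continuous_cutoff hr0
  have hc0 : cutoff r 0 = 0 := cutoff_of_le hr0.le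
  have he := continuous_truncation s
  have he0 := truncation_zero hs0
  have hec : Continuous fun t : ℝ => truncation s t * cutoff r t := he.mul hc
  set c := cfcₙ (cutoff r) b with hcdef
  set e := cfcₙ (truncation s) b with hedef
  have hnorm : ‖e - e * c‖ ≤ r / s := by
    rw [hcdef, hedef, ← cfcₙ_mul _ _ b he.continuousOn he0 hc.continuousOn hc0,
      ← cfcₙ_sub _ _ b he.continuousOn he0 hec.continuousOn (by simp [hc0])]
    refine norm_cfcₙ_le fun t ht => ?_
    have h0 := quasispectrum_real_star_mul_self_nonneg a t ht
    have h1 : 0 ≤ truncation s t := div_nonneg (le_min h0 hs0.le) hs0.le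
    have h2 : truncation s t ≤ t / s := by
      unfold truncation; gcongr; exact min_le_left _ _
    rcases le_total t r with h | h
    · rw [cutoff_of_le h, mul_zero, sub_zero, Real.norm_of_nonneg h1]
      exact h2.trans (by gcongr)
    · have ht0 : 0 < t := hr0.trans_le h
      rw [cutoff_of_ge hr0 h, show truncation s t - truncation s t * (1 - r / t)
        = truncation s t * (r / t) by ring, Real.norm_of_nonneg (by positivity)]
      refine (mul_le_mul_of_nonneg_right h2 (by positivity)).trans_eq ?_
      field_simp
  have h1 := quotNorm_add_le (J := J) (e - e * c) (e * c)
  have h2 := hJ.quotNorm_mul_le e c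
  rw [hq, mul_zero] at h2
  rw [sub_add_cancel] at h1
  have h3 : r / s < 1 := (div_lt_one hs0).2 hrs
  linarith [quotNorm_le_norm (J := J) (e - e * c)]

end Cutoff

/-! ### Existence of primitive ideals -/

section Existence

variable {A : Type u} [NonUnitalCStarAlgebra A]

theorem exists_left_quasiinverse {d : A} (hd : ‖d‖ < 1) : ∃ y : A, y - y * d = d := by
  have h1 : IsUnit (1 - (d : Unitization ℂ A)) :=
    isUnit_one_sub_of_norm_lt_one (by rwa [Unitization.norm_inr])
  rw [sub_eq_add_neg, ← Unitization.inr_neg, ← isQuasiregular_iff_isUnit,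
    Unitization.isQuasiregular_inr_iff, isQuasiregular_iff] at h1
  obtain ⟨y, -, hy⟩ := h1
  refine ⟨y, ?_⟩
  rw [mul_neg] at hy
  rw [← sub_eq_zero, ← hy]
  abel

/-- The left multiplication of `A` on the quotient by a left ideal. -/
noncomputable def leftQuotientRep (N : Submodule ℂ A) (hN : ∀ x : A, ∀ n ∈ N, x * n ∈ N) :
    A →ₙₐ[ℂ] Module.End ℂ (A ⧸ N) where
  toFun a := N.mapQ N (LinearMap.mulLeft ℂ a) (fun n hn => hN a n hn)
  map_smul' c a := by
    refine LinearMap.ext fun ξ => ?_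
    obtain ⟨x, rfl⟩ := Submodule.Quotient.mk_surjective N ξ
    exact congrArg Submodule.Quotient.mk (smul_mul_assoc c a x)
  map_zero' := by
    refine LinearMap.ext fun ξ => ?_
    obtain ⟨x, rfl⟩ := Submodule.Quotient.mk_surjective N ξ
    simp
  map_add' a b := by
    refine LinearMap.ext fun ξ => ?_
    obtain ⟨x, rfl⟩ := Submodule.Quotient.mk_surjective N ξ
    exact congrArg Submodule.Quotient.mk (add_mul a b x)
  map_mul' a b := by
    refine LinearMap.ext fun ξ => ?_
    obtain ⟨x, rfl⟩ := Submodule.Quotient.mk_surjective N ξ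
    exact congrArg Submodule.Quotient.mk (mul_assoc a b x)

theorem leftQuotientRep_mk (N : Submodule ℂ A) (hN : ∀ x : A, ∀ n ∈ N, x * n ∈ N) (a x : A) :
    leftQuotientRep N hN a (Submodule.Quotient.mk x) = Submodule.Quotient.mk (a * x) := rfl

/-- Since `e` is a right unit modulo `N`, a left ideal containing `N` and `e` is all of `A`.
Maximality with respect to omitting `e` thus makes `N` a maximal left ideal. -/
theorem isStrictlyIrreducible_leftQuotientRep {N : Submodule ℂ A}
    (hN : ∀ x : A, ∀ n ∈ N, x * n ∈ N) {e : A} (he : e ∉ N) (hmod : ∀ x : A, x - x * e ∈ N)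
    (hmax : ∀ L : Submodule ℂ A, (∀ x : A, ∀ n ∈ L, x * n ∈ L) → N ≤ L → e ∉ L → L ≤ N) :
    IsStrictlyIrreducible (leftQuotientRep N hN) := by
  have htop : ∀ L : Submodule ℂ A, (∀ x : A, ∀ n ∈ L, x * n ∈ L) → N ≤ L → ∀ z ∈ L, z ∉ N →
      ∀ y, y ∈ L := by
    intro L hL hNL z hz hzN y
    have heL : e ∈ L := by
      by_contra h
      exact hzN (hmax L hL hNL h hz)
    have := L.add_mem (hNL (hmod y)) (hL y e heL)
    rwa [sub_add_cancel] at this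
  refine ⟨⟨Submodule.Quotient.mk e, 0, fun h => he ((Submodule.Quotient.mk_eq_zero N).1 h)⟩, ?_⟩
  intro ξ hξ
  obtain ⟨x, rfl⟩ := Submodule.Quotient.mk_surjective N ξ
  have hx : x ∉ N := fun h => hξ ((Submodule.Quotient.mk_eq_zero N).2 h)
  -- the elements annihilated by `A` modulo `N`
  have hann : ∃ a, a * x ∉ N := by
    by_contra! hcon
    let L : Submodule ℂ A :=
      { carrier := {y | ∀ a, a * y ∈ N}
        add_mem' := fun hy hz a => by rw [mul_add]; exact N.add_mem (hy a) (hz a)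
        zero_mem' := fun a => by rw [mul_zero]; exact N.zero_mem
        smul_mem' := fun c y hy a => by rw [mul_smul_comm]; exact N.smul_mem c (hy a) }
    have heL : e ∈ L := htop L (fun b y hy a => by rw [← mul_assoc]; exact hy _)
      (fun n hn a => hN a n hn) x hcon hx e
    have := N.add_mem (hmod e) (heL e)
    rw [sub_add_cancel] at this
    exact he this
  obtain ⟨a, ha⟩ := hann
  -- The left ideal `N + A * x` contains `a * x ∉ N`, hence is everything: the orbit of the class of
  -- `x` fills the quotient.
  let L : Submodule ℂ A := N ⊔ LinearMap.range (LinearMap.mulRight ℂ x)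
  have hL : ∀ b : A, ∀ n ∈ L, b * n ∈ L := by
    intro b n hn
    obtain ⟨m, hm, _, ⟨c, rfl⟩, rfl⟩ := Submodule.mem_sup.1 hn
    rw [mul_add]
    refine Submodule.add_mem_sup (hN b m hm) ⟨b * c, ?_⟩
    simp [mul_assoc]
  refine Set.eq_univ_of_forall fun η => ?_
  obtain ⟨y, rfl⟩ := Submodule.Quotient.mk_surjective N η
  have hy : y ∈ L := htop L hL le_sup_left (a * x) (Submodule.mem_sup_right ⟨a, rfl⟩) ha y
  obtain ⟨m, hm, _, ⟨c, rfl⟩, rfl⟩ := Submodule.mem_sup.1 hy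
  refine ⟨c, ?_⟩
  rw [leftQuotientRep_mk, Submodule.Quotient.eq]
  simpa using hm

theorem PrimitiveSpace.smul_mem (I : PrimitiveSpace A) (c : ℂ) {a : A} :
    a ∈ I.1 → c • a ∈ I.1 := by
  obtain ⟨I, X, _, _, π, -, hI⟩ := I
  intro ha
  rw [hI] at ha ⊢
  rw [map_smul, ha, smul_zero]

/-- A primitive ideal as a linear subspace. -/
def PrimitiveSpace.toSubmodule (I : PrimitiveSpace A) : Submodule ℂ A where
  carrier := I.1
  add_mem' := I.1.add_mem
  zero_mem' := I.1.zero_mem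
  smul_mem' c _ := I.smul_mem c

theorem PrimitiveSpace.mem_toSubmodule {I : PrimitiveSpace A} {a : A} :
    a ∈ I.toSubmodule ↔ a ∈ I.1 := Iff.rfl

theorem PrimitiveSpace.isTwoSidedSubmodule (I : PrimitiveSpace A) :
    IsTwoSidedSubmodule I.toSubmodule :=
  ⟨fun x _ hj => I.1.mul_mem_left x _ hj, fun x _ hj => I.1.mul_mem_right _ x hj⟩

/-- A left ideal which does not contain `e` is contained in a left ideal that is
maximal with this property. -/
theorem exists_maximal_leftIdeal {L : Submodule ℂ A} (hL : ∀ x : A, ∀ n ∈ L, x * n ∈ L) {e : A}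
    (he : e ∉ L) : ∃ N : Submodule ℂ A, L ≤ N ∧ (∀ x : A, ∀ n ∈ N, x * n ∈ N) ∧ e ∉ N ∧
      ∀ K : Submodule ℂ A, (∀ x : A, ∀ n ∈ K, x * n ∈ K) → N ≤ K → e ∉ K → K ≤ N := by
  obtain ⟨N, hLN, hN⟩ := zorn_le_nonempty₀
    {N : Submodule ℂ A | (∀ x : A, ∀ n ∈ N, x * n ∈ N) ∧ e ∉ N} (by
      intro c hc hchain K hK
      have hmem : ∀ {z : A}, z ∈ sSup c ↔ ∃ N ∈ c, z ∈ N :=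
        Submodule.mem_sSup_of_directed ⟨K, hK⟩ hchain.directedOn
      refine ⟨sSup c, ⟨fun x n hn => ?_, fun hcon => ?_⟩, fun N hN => le_sSup hN⟩
      · obtain ⟨N, hN, hnN⟩ := hmem.1 hn
        exact hmem.2 ⟨N, hN, (hc hN).1 x n hnN⟩
      · obtain ⟨N, hN, heN⟩ := hmem.1 hcon
        exact (hc hN).2 heN) L ⟨hL, he⟩
  exact ⟨N, hLN, hN.prop.1, hN.prop.2, fun K hK hNK heK => hN.le_of_ge ⟨hK, heK⟩ hNK⟩

/-- The hypothesis says that the left ideal `J + A(1 - e)` omits `e`. Enlarge it to a maximal such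
`N` and take the kernel of the action on `A ⧸ N`. -/
theorem IsTwoSidedSubmodule.exists_primitive_of_not_quasiregular {J : Submodule ℂ A}
    (hJ : IsTwoSidedSubmodule J) {e : A} (he : ∀ x : A, e - x + x * e ∉ J) :
    ∃ I : PrimitiveSpace A, J ≤ I.toSubmodule ∧ 1 ≤ quotNorm I.toSubmodule e := by
  let L : Submodule ℂ A := J ⊔ LinearMap.range (LinearMap.id - LinearMap.mulRight ℂ e)
  have hL : ∀ b : A, ∀ n ∈ L, b * n ∈ L := by
    intro b n hn
    obtain ⟨m, hm, _, ⟨c, rfl⟩, rfl⟩ := Submodule.mem_sup.1 hn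
    rw [mul_add]
    refine Submodule.add_mem_sup (hJ.mul_mem_left b hm) ⟨b * c, ?_⟩
    simp [mul_assoc, mul_sub]
  have heL : e ∉ L := by
    intro h
    obtain ⟨m, hm, _, ⟨c, rfl⟩, h⟩ := Submodule.mem_sup.1 h
    refine he c ?_
    convert hm using 1
    rw [← sub_eq_zero, ← sub_eq_zero.2 h.symm]
    simp
    abel
  obtain ⟨N, hLN, hN, heN, hmax⟩ := exists_maximal_leftIdeal hL heL
  have hmod : ∀ x : A, x - x * e ∈ N := fun x => hLN (Submodule.mem_sup_right ⟨x, by simp⟩)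
  have hker : ∀ a : A, leftQuotientRep N hN a = 0 ↔ ∀ x, a * x ∈ N := by
    intro a
    constructor
    · intro h x
      rw [← Submodule.Quotient.mk_eq_zero, ← leftQuotientRep_mk N hN, h, LinearMap.zero_apply]
    · intro h
      refine LinearMap.ext fun ξ => ?_
      obtain ⟨x, rfl⟩ := Submodule.Quotient.mk_surjective N ξ
      rw [leftQuotientRep_mk, LinearMap.zero_apply, Submodule.Quotient.mk_eq_zero]
      exact h x
  let I : PrimitiveSpace A := ⟨TwoSidedIdeal.ker (leftQuotientRep N hN), A ⧸ N, _, _,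
    leftQuotientRep N hN, isStrictlyIrreducible_leftQuotientRep hN heN hmod hmax,
    fun a => TwoSidedIdeal.mem_ker _⟩
  have hI : ∀ a : A, a ∈ I.toSubmodule ↔ ∀ x, a * x ∈ N := fun a =>
    (TwoSidedIdeal.mem_ker _).trans (hker a)
  refine ⟨I, fun j hj => (hI j).2 fun x => hLN (Submodule.mem_sup_left (hJ.mul_mem_right x hj)), ?_⟩
  have hIN : ∀ a ∈ I.toSubmodule, a ∈ N := fun a ha => by
    have := N.add_mem (hmod a) ((hI a).1 ha e)
    rwa [sub_add_cancel] at this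
  -- Otherwise `e` is congruent modulo the kernel to some `d` with `‖d‖ < 1`; the left quasi-inverse
  -- of `d` then brings `d`, and so `e`, into `N`.
  by_contra! hlt
  obtain ⟨d, hd, hd1⟩ := quotNorm_lt_iff.1 hlt
  obtain ⟨y, hy⟩ := exists_left_quasiinverse hd1
  -- `d` is a modular unit of `N` as well
  have hdN : d ∈ N := by
    have h := N.add_mem (hmod y) (hIN _ (I.isTwoSidedSubmodule.mul_mem_left y hd))
    rw [← hy]
    convert h using 1
    noncomm_ring
  refine heN ?_
  have := N.add_mem (hIN _ hd) hdN
  rwa [sub_add_cancel] at this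

theorem IsTwoSidedSubmodule.exists_primitive_quotNorm_le {J : Submodule ℂ A}
    (hJ : IsTwoSidedSubmodule J) {a : A} (ha : 0 < quotNorm J a) :
    ∃ I : PrimitiveSpace A, J ≤ I.toSubmodule ∧ quotNorm J a ≤ quotNorm I.toSubmodule a := by
  obtain ⟨I, hJI, hI⟩ :=
    hJ.exists_primitive_of_not_quasiregular (hJ.truncation_not_quasiregular ha)
  refine ⟨I, hJI, ?_⟩
  by_contra! hlt
  exact hI.not_gt (I.isTwoSidedSubmodule.quotNorm_truncation_lt_one
    (pow_lt_pow_left₀ hlt (quotNorm_nonneg a) two_ne_zero))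

end Existence

/-! ### Suprema of quotient norms over totally bounded sets -/

section Sup

variable {A : Type u} [NonUnitalCStarAlgebra A] {J : Submodule ℂ A} {N : Set A}

theorem bddAbove_quotNorm_image (hN : TotallyBounded N) : BddAbove (quotNorm J '' N) := by
  obtain ⟨C, hC⟩ := hN.isBounded.exists_norm_le
  exact ⟨C, Set.forall_mem_image.2 fun a ha => (quotNorm_le_norm a).trans (hC a ha)⟩

theorem sSup_quotNorm_nonneg : 0 ≤ sSup (quotNorm J '' N) :=
  Real.sSup_nonneg (Set.forall_mem_image.2 fun _ _ => quotNorm_nonneg _)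

theorem quotNorm_le_sSup (hN : TotallyBounded N) {a : A} (ha : a ∈ closure N) :
    quotNorm J a ≤ sSup (quotNorm J '' N) :=
  closure_minimal (fun _ hb => le_csSup (bddAbove_quotNorm_image hN) (Set.mem_image_of_mem _ hb))
    (isClosed_le continuous_quotNorm continuous_const) ha

theorem exists_mem_closure_le_quotNorm (hN : TotallyBounded N) {k : ℝ} (hk : 0 < k)
    (h : k ≤ sSup (quotNorm J '' N)) : ∃ a ∈ closure N, k ≤ quotNorm J a := by
  -- For empty `N` the supremum is `0` by convention, which `0 < k` excludes.
  have hne : N.Nonempty := by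
    by_contra hcon
    rw [Set.not_nonempty_iff_eq_empty] at hcon
    simp [hcon] at h
    linarith
  obtain ⟨a, ha, hmax⟩ := (hN.closure.isCompact_of_isClosed isClosed_closure).exists_isMaxOn
    hne.closure (continuous_quotNorm (J := J)).continuousOn
  exact ⟨a, ha, h.trans (csSup_le (hne.image _)
    (Set.forall_mem_image.2 fun b hb => hmax (subset_closure hb)))⟩

theorem PrimitiveSpace.exists_hull_eq {Z : Set (PrimitiveSpace A)} (hZ : IsClosed Z) :
    ∃ E : Set A, hull E = Z := by
  have h : Zᶜᶜ ∈ Set.range (hull (A := A)) := hZ.isOpen_compl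
  rwa [compl_compl] at h

/-- Suppose all finite intersections of the closed sets `t i` meet the set. Their kernels `Jf u`
increase with `u`, and a primitive ideal above the union lies in every `t i`, so it suffices that
the bound `k` survives in the quotient by the union. -/
theorem PrimitiveSpace.isCompact_le_sSup_quotNorm (hN : TotallyBounded N) {k : ℝ} (hk : 0 < k) :
    IsCompact {I : PrimitiveSpace A | k ≤ sSup (quotNorm I.toSubmodule '' N)} := by
  classical
  refine isCompact_of_finite_subfamily_closed fun {ι} t ht hempty => ?_
  by_contra! hcon
  let Jf : Finset ι → Submodule ℂ A := fun u =>
    ⨅ I : {I : PrimitiveSpace A // I ∈ ⋂ i ∈ u, t i}, I.1.toSubmodule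
  have hJf : ∀ u, ∀ I ∈ ⋂ i ∈ u, t i, Jf u ≤ I.toSubmodule := fun u I hI =>
    iInf_le (fun I : {I : PrimitiveSpace A // I ∈ ⋂ i ∈ u, t i} => I.1.toSubmodule) ⟨I, hI⟩
  have hmono : Monotone Jf := fun u v huv => le_iInf fun I =>
    hJf u I.1 (Set.biInter_subset_biInter_left huv I.2)
  have hmem : ∀ {x : A}, x ∈ ⨆ u, Jf u ↔ ∃ u, x ∈ Jf u :=
    Submodule.mem_iSup_of_directed Jf hmono.directed_le
  have hJ : IsTwoSidedSubmodule (⨆ u, Jf u) := by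
    constructor
    · intro x j hj
      obtain ⟨u, hu⟩ := hmem.1 hj
      exact hmem.2 ⟨u, (Submodule.mem_iInf _).2 fun I =>
        I.1.isTwoSidedSubmodule.mul_mem_left x ((Submodule.mem_iInf _).1 hu I)⟩
    · intro x j hj
      obtain ⟨u, hu⟩ := hmem.1 hj
      exact hmem.2 ⟨u, (Submodule.mem_iInf _).2 fun I =>
        I.1.isTwoSidedSubmodule.mul_mem_right x ((Submodule.mem_iInf _).1 hu I)⟩
  -- A Dini-type argument: a strict inequality for the union is already witnessed at some `u`, and
  -- by compactness of `closure N` one `u` serves all `a`, contradicting the point of the set found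
  -- in the intersection over `u`.
  have hex : ∃ a ∈ closure N, k ≤ quotNorm (⨆ u, Jf u) a := by
    by_contra! hlt
    let U : Finset ι → Set A := fun u => {a | quotNorm (Jf u) a < k}
    have hUopen : ∀ u, IsOpen (U u) := fun u => isOpen_lt continuous_quotNorm continuous_const
    have hUmono : Monotone U := fun u v huv a ha => (quotNorm_anti (hmono huv) a).trans_lt ha
    have hUdir : Directed (· ⊆ ·) U := fun u v =>
      ⟨u ∪ v, hUmono Finset.subset_union_left, hUmono Finset.subset_union_right⟩
    have hcover : closure N ⊆ ⋃ u, U u := fun a ha => by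
      obtain ⟨m, hm, hmk⟩ := quotNorm_lt_iff.1 (hlt a ha)
      obtain ⟨u, hu⟩ := hmem.1 hm
      exact Set.mem_iUnion.2 ⟨u, quotNorm_lt_iff.2 ⟨m, hu, hmk⟩⟩
    obtain ⟨u, hu⟩ := (hN.closure.isCompact_of_isClosed isClosed_closure).elim_directed_cover
      U hUopen hcover hUdir
    obtain ⟨I, hIk, hIu⟩ := hcon u
    obtain ⟨a, ha, hka⟩ := exists_mem_closure_le_quotNorm hN hk hIk
    have h1 : quotNorm I.toSubmodule a ≤ quotNorm (Jf u) a :=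
      quotNorm_anti (hJf u I hIu) a
    exact (hka.trans h1).not_gt (hu ha)
  obtain ⟨a, ha, hka⟩ := hex
  obtain ⟨I, hJI, hI⟩ := hJ.exists_primitive_quotNorm_le (hk.trans_le hka)
  have hIs : I ∈ {I : PrimitiveSpace A | k ≤ sSup (quotNorm I.toSubmodule '' N)} ∩ ⋂ i, t i := by
    refine ⟨(hka.trans hI).trans (quotNorm_le_sSup hN ha), Set.mem_iInter.2 fun i => ?_⟩
    obtain ⟨E, hE⟩ := PrimitiveSpace.exists_hull_eq (ht i)
    rw [← hE]
    refine fun x hx => hJI (hmem.2 ⟨{i}, (Submodule.mem_iInf _).2 fun K => ?_⟩)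
    have hK : K.1 ∈ hull E := by
      rw [hE]
      simpa using K.2
    exact hK hx
  rw [hempty] at hIs
  exact hIs

end Sup

/-! ### Powers of a set -/

section Powers

theorem setPowSucc_add {B : Type*} [Semigroup B] [Norm B] (M : Set B) (n m : ℕ) :
    setPowSucc M (n + m + 1) = Set.image2 (· * ·) (setPowSucc M n) (setPowSucc M m) := by
  induction m with
  | zero => rfl
  | succ m ih =>
    change Set.image2 _ (setPowSucc M (n + m + 1)) M
      = Set.image2 _ _ (Set.image2 _ (setPowSucc M m) M)
    rw [ih]
    exact Set.image2_assoc mul_assoc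

variable {A : Type u} [NonUnitalCStarAlgebra A] {M : Set A}

theorem totallyBounded_setPowSucc (hM : TotallyBounded M) (n : ℕ) :
    TotallyBounded (setPowSucc M n) := by
  induction n with
  | zero => exact hM
  | succ n ih =>
    have h := ((ih.closure.isCompact_of_isClosed isClosed_closure).prod
      (hM.closure.isCompact_of_isClosed isClosed_closure)).image (continuous_mul (M := A))
    refine h.totallyBounded.subset ?_
    rintro _ ⟨a, ha, b, hb, rfl⟩
    exact ⟨(a, b), ⟨subset_closure ha, subset_closure hb⟩, rfl⟩

theorem IsTwoSidedSubmodule.sSup_quotNorm_setPowSucc_add_le {J : Submodule ℂ A}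
    (hJ : IsTwoSidedSubmodule J) (hM : TotallyBounded M) (n m : ℕ) :
    sSup (quotNorm J '' setPowSucc M (n + m + 1))
      ≤ sSup (quotNorm J '' setPowSucc M n) * sSup (quotNorm J '' setPowSucc M m) := by
  refine Real.sSup_le (Set.forall_mem_image.2 fun x hx => ?_)
    (mul_nonneg sSup_quotNorm_nonneg sSup_quotNorm_nonneg)
  rw [setPowSucc_add] at hx
  obtain ⟨a, ha, b, hb, rfl⟩ := hx
  exact (hJ.quotNorm_mul_le a b).trans (mul_le_mul
    (quotNorm_le_sSup (totallyBounded_setPowSucc hM n) (subset_closure ha))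
    (quotNorm_le_sSup (totallyBounded_setPowSucc hM m) (subset_closure hb))
    (quotNorm_nonneg b) sSup_quotNorm_nonneg)

/-- Indices are shifted by one: `n * m + n + m` stands for the exponent `(n + 1) * (m + 1)`. -/
theorem IsTwoSidedSubmodule.sSup_quotNorm_setPowSucc_mul_le {J : Submodule ℂ A}
    (hJ : IsTwoSidedSubmodule J) (hM : TotallyBounded M) (n m : ℕ) :
    sSup (quotNorm J '' setPowSucc M (n * m + n + m))
      ≤ sSup (quotNorm J '' setPowSucc M n) ^ (m + 1) := by
  induction m with
  | zero => simp
  | succ m ih =>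
    rw [show n * (m + 1) + n + (m + 1) = (n * m + n + m) + n + 1 by ring, pow_succ]
    exact (hJ.sSup_quotNorm_setPowSucc_add_le hM _ _).trans
      (mul_le_mul_of_nonneg_right ih sSup_quotNorm_nonneg)

theorem setPowSucc_setQuotient (I : TwoSidedIdeal A) (n : ℕ) :
    setPowSucc (setQuotient M I) n = setQuotient (setPowSucc M n) I := by
  induction n with
  | zero => rfl
  | succ n ih =>
    change Set.image2 _ (setPowSucc (setQuotient M I) n) _ = _
    rw [ih]
    exact (Set.image_image2_distrib (f := fun a b : A => a * b)
      (g := fun a : A => (a : I.ringCon.Quotient)) fun _ _ => rfl).symm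

theorem PrimitiveSpace.norm_coe_eq_quotNorm (I : PrimitiveSpace A) (a : A) :
    ‖(a : I.1.ringCon.Quotient)‖ = quotNorm I.toSubmodule a := by
  have hlt : ∀ r, ‖(a : I.1.ringCon.Quotient)‖ < r ↔ quotNorm I.toSubmodule a < r := by
    intro r
    rw [quotNorm_lt_iff]
    have hne : {b : A | (b : I.1.ringCon.Quotient) = a}.Nonempty := ⟨a, rfl⟩
    have hbdd : BddBelow ((fun b : A => ‖b‖) '' {b : A | (b : I.1.ringCon.Quotient) = a}) :=
      ⟨0, Set.forall_mem_image.2 fun b _ => norm_nonneg b⟩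
    refine (csInf_lt_iff hbdd (hne.image _)).trans (Set.exists_mem_image.trans ?_)
    refine exists_congr fun m => and_congr_left fun _ => ?_
    rw [Set.mem_ofPred_eq, eq_comm, RingCon.eq, TwoSidedIdeal.rel_iff, I.mem_toSubmodule]
  exact le_antisymm (le_of_forall_gt fun r hr => (hlt r).2 hr)
    (le_of_forall_gt fun r hr => (hlt r).1 hr)

theorem PrimitiveSpace.setNorm_setPowSucc_setQuotient (I : PrimitiveSpace A) (n : ℕ) :
    setNorm (setPowSucc (setQuotient M I.1) n)
      = sSup (quotNorm I.toSubmodule '' setPowSucc M n) := by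
  rw [setPowSucc_setQuotient, setNorm, setQuotient, Set.image_image]
  simp only [I.norm_coe_eq_quotNorm]

end Powers

/-! ### The joint spectral radius -/

section Radius

theorem jointSpectralRadius_nonneg_of {B : Type*} [Mul B] [Norm B] {M : Set B}
    (h : ∀ n, 0 ≤ setNorm (setPowSucc M n)) : 0 ≤ jointSpectralRadius M :=
  Real.iInf_nonneg fun n => Real.rpow_nonneg (h n) _

theorem jointSpectralRadius_le_of {B : Type*} [Mul B] [Norm B] {M : Set B}
    (h : ∀ n, 0 ≤ setNorm (setPowSucc M n)) (n : ℕ) :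
    jointSpectralRadius M ≤ setNorm (setPowSucc M n) ^ (1 / ((n : ℝ) + 1)) :=
  ciInf_le ⟨0, Set.forall_mem_range.2 fun n => Real.rpow_nonneg (h n) _⟩ n

variable {A : Type u} [NonUnitalCStarAlgebra A] {M : Set A}

theorem setNorm_eq_sSup_quotNorm_bot (N : Set A) :
    setNorm N = sSup (quotNorm (⊥ : Submodule ℂ A) '' N) := by
  simp only [setNorm, quotNorm_bot, Set.image]

theorem isTwoSidedSubmodule_bot : IsTwoSidedSubmodule (⊥ : Submodule ℂ A) :=
  ⟨fun x j hj => by simp_all, fun x j hj => by simp_all⟩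

theorem PrimitiveSpace.setNorm_setPowSucc_setQuotient_le (hM : TotallyBounded M)
    (I : PrimitiveSpace A) (n : ℕ) :
    setNorm (setPowSucc (setQuotient M I.1) n) ≤ setNorm (setPowSucc M n) := by
  rw [I.setNorm_setPowSucc_setQuotient, setNorm_eq_sSup_quotNorm_bot]
  refine Real.sSup_le (Set.forall_mem_image.2 fun a ha => ?_) sSup_quotNorm_nonneg
  exact (quotNorm_anti bot_le a).trans
    (quotNorm_le_sSup (totallyBounded_setPowSucc hM n) (subset_closure ha))

theorem PrimitiveSpace.jointSpectralRadius_setQuotient_nonneg (I : PrimitiveSpace A) :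
    0 ≤ jointSpectralRadius (setQuotient M I.1) :=
  jointSpectralRadius_nonneg_of fun n => by
    rw [I.setNorm_setPowSucc_setQuotient]; exact sSup_quotNorm_nonneg

theorem PrimitiveSpace.jointSpectralRadius_setQuotient_le (hM : TotallyBounded M)
    (I : PrimitiveSpace A) : jointSpectralRadius (setQuotient M I.1) ≤ jointSpectralRadius M := by
  have h0 : ∀ n, 0 ≤ setNorm (setPowSucc (setQuotient M I.1) n) := fun n => by
    rw [I.setNorm_setPowSucc_setQuotient]; exact sSup_quotNorm_nonneg
  refine le_ciInf fun n => (jointSpectralRadius_le_of h0 n).trans ?_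
  exact Real.rpow_le_rpow (h0 n) (I.setNorm_setPowSucc_setQuotient_le hM n) (by positivity)

theorem PrimitiveSpace.exists_le_jointSpectralRadius (hA : PropertyQC (PrimitiveSpace A))
    (hM : TotallyBounded M) {t : ℝ} (ht : 0 < t) (htM : t < jointSpectralRadius M) :
    ∃ I : PrimitiveSpace A, t ≤ jointSpectralRadius (setQuotient M I.1) := by
  let K : ℕ → Set (PrimitiveSpace A) := fun n =>
    {I | t ^ (n + 1) ≤ sSup (quotNorm I.toSubmodule '' setPowSucc M n)}
  have hsub : ∀ n m, K (n * m + n + m) ⊆ K n := by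
    intro n m I hI
    have h := hI.trans (I.isTwoSidedSubmodule.sSup_quotNorm_setPowSucc_mul_le hM n m)
    rw [show n * m + n + m + 1 = (n + 1) * (m + 1) by ring, pow_mul] at h
    exact (pow_le_pow_iff_left₀ (by positivity) sSup_quotNorm_nonneg m.succ_ne_zero).1 h
  have hdir : DirectedOn (fun K L => L ⊆ K) (Set.range K) := by
    rintro _ ⟨n, rfl⟩ _ ⟨m, rfl⟩
    refine ⟨_, ⟨n * m + n + m, rfl⟩, hsub n m, ?_⟩
    rw [show n * m + n + m = m * n + m + n by ring]
    exact hsub m n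
  have hK : ∀ L ∈ Set.range K, L.Nonempty ∧ IsCompact L := by
    rintro _ ⟨n, rfl⟩
    have hN := totallyBounded_setPowSucc hM n
    refine ⟨?_, PrimitiveSpace.isCompact_le_sSup_quotNorm hN (by positivity)⟩
    have h0 : ∀ n, 0 ≤ setNorm (setPowSucc M n) := fun n => by
      rw [setNorm_eq_sSup_quotNorm_bot]; exact sSup_quotNorm_nonneg
    have h1 := pow_le_pow_left₀ ht.le (htM.le.trans (jointSpectralRadius_le_of h0 n)) (n + 1)
    rw [← Real.rpow_natCast (_ ^ _), ← Real.rpow_mul (h0 n), Nat.cast_succ, one_div,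
      inv_mul_cancel₀ (by positivity), Real.rpow_one, setNorm_eq_sSup_quotNorm_bot] at h1
    obtain ⟨a, ha, hta⟩ := exists_mem_closure_le_quotNorm hN (by positivity) h1
    have hpos : 0 < t ^ (n + 1) := by positivity
    obtain ⟨I, -, hI⟩ := isTwoSidedSubmodule_bot.exists_primitive_quotNorm_le (hpos.trans_le hta)
    exact ⟨I, (hta.trans hI).trans (quotNorm_le_sSup hN ha)⟩
  obtain ⟨I, hI⟩ := hA (Set.range K) (Set.range_nonempty K) hdir hK
  refine ⟨I, le_ciInf fun n => ?_⟩
  have hIn : I ∈ K n := hI _ ⟨n, rfl⟩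
  rw [I.setNorm_setPowSucc_setQuotient, one_div,
    Real.le_rpow_inv_iff_of_pos ht.le sSup_quotNorm_nonneg (by positivity), ← Nat.cast_succ,
    Real.rpow_natCast]
  exact hIn

end Radius

theorem mainTheorem12 {A : Type u} [NonUnitalCStarAlgebra A]
    (hA : PropertyQC (PrimitiveSpace A)) (M : Set A) (hM : TotallyBounded M) :
    BddAbove (Set.range fun I : PrimitiveSpace A => jointSpectralRadius (setQuotient M I.1)) ∧
      jointSpectralRadius M =
        ⨆ I : PrimitiveSpace A, jointSpectralRadius (setQuotient M I.1) := by
  have hle := fun I : PrimitiveSpace A => I.jointSpectralRadius_setQuotient_le hM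
  have hbdd : BddAbove (Set.range fun I : PrimitiveSpace A =>
      jointSpectralRadius (setQuotient M I.1)) := ⟨_, Set.forall_mem_range.2 hle⟩
  have h0 : 0 ≤ jointSpectralRadius M := jointSpectralRadius_nonneg_of fun n => by
    rw [setNorm_eq_sSup_quotNorm_bot]; exact sSup_quotNorm_nonneg
  refine ⟨hbdd, le_antisymm ?_ (Real.iSup_le hle h0)⟩
  by_contra! hlt
  obtain ⟨t, ht, htM⟩ := exists_between hlt
  -- This covers an empty primitive space too, where the real supremum is `0`.
  have ht0 : 0 < t :=
    (Real.iSup_nonneg fun I : PrimitiveSpace A =>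
      I.jointSpectralRadius_setQuotient_nonneg).trans_lt ht
  obtain ⟨I, hI⟩ := PrimitiveSpace.exists_le_jointSpectralRadius hA hM ht0 htM
  exact (hI.trans (le_ciSup hbdd I)).not_gt ht
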